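/- Let $I=(0,1)$, $T>0$, $\lambda\ge 0$, and let $\psi\in C([0,1])$ with $\psi(0)<0$ and $\psi(1)<0$. Put $H(I):=H^2(I)\cap H^1_0(I)$, with the $H^2(I)$-topology, $$K:=\{v\in H(I)\mid v\ge\psi \text{ in } I\},$$ $$K_T:=\{u\in L^\infty(0,T;H(I))\cap H^1(0,T;L^2(I))\mid u\ge\psi\text{ in } I\times(0,T)\}.$$ A prime denotes the derivative in $x$, and $|\gamma_u'|:=(1+(u')^2)^{1/2}$. Let $u_0\in K$. A function $u$ is called a weak solution (of the obstacle problem for the length-penalized elastic flow of graphs, with initial datum $u_0$) if $u\in K_T$, if $$\int_0^T\!\!\int_I\Big[\frac{\partial_t u\,(v-u)}{|\gamma_u'|}+2\frac{u''(v-u)''}{|\gamma_u'|^5}-5\frac{|u''|^2u'(v-u)'}{|\gamma_u'|^7}-\lambda\frac{u''(v-u)}{|\gamma_u'|^3}\Big]\,\mathrm dx\,\mathrm dt\ \ge 0\qquad\text{for all } v\in K_T,$$ and if the $C([0,T];L^2(I))$-representative of $u$ satisfies $u(0)=u_0$. **Proposition 3.1.** Let $u\in K_T$ be a weak solution, and fix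 representatives $t\mapsto u(\cdot,t)\in H(I)$ and $t\mapsto\partial_t u(\cdot,t)\in L^2(I)$. Then there is a set $S\subset[0,T]$ such that $[0,T]\setminus S$ has measure zero and, for all $t\in S$ and all (time-independent) $v\in K$, the integrand below is integrable over $I$ and $$\int_I\Big[\frac{\partial_t u\,(v-u)}{|\gamma_u'|}+2\frac{u''(v-u)''}{|\gamma_u'|^5}-5\frac{|u''|^2u'(v-u)'}{|\gamma_u'|^7}-\lambda\frac{u''(v-u)}{|\gamma_u'|^3}\Big]\,\mathrm dx\ \ge 0,$$ where $u$, $\partial_t u$ and their derivatives in $x$ are evaluated at time $t$. In particular, $S$ does not depend on $v$. -/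

import Mathlib

open MeasureTheory Set
open scoped ContDiff

namespace ObstacleFlow

noncomputable section

/-- Test functions on the open interval `(a, b)`: the real-valued smooth functions with compact
support contained in `(a, b)`. -/
structure IsTestFunction (a b : ℝ) (φ : ℝ → ℝ) : Prop where
  smooth : ContDiff ℝ ∞ φ
  compact : HasCompactSupport φ
  support : tsupport φ ⊆ Ioo a b

/-- `g` is the weak (distributional) derivative of `f` on the interval `(a, b)`. It is used for
functions that are (Bochner) integrable on `(a, b)`, with values in a Banach space `E`: with
`E = ℝ` for derivatives in space, with `E = L²(0, 1)` for derivatives in time. -/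
def IsWeakDeriv {E : Type*} [NormedAddCommGroup E] [NormedSpace ℝ E] (a b : ℝ)
    (f g : ℝ → E) : Prop :=
  ∀ φ : ℝ → ℝ, IsTestFunction a b φ →
    ∫ s in Ioo a b, deriv φ s • f s = -∫ s in Ioo a b, φ s • g s

/-- Lebesgue measure on `I = (0, 1)`. -/
abbrev volI : Measure ℝ := volume.restrict (Ioo 0 1)

/-- The space `L²(I)`, where `I = (0, 1)`. -/
abbrev L2I : Type := Lp ℝ 2 volI

theorem IsTestFunction.integrable_mul {φ : ℝ → ℝ} (hφ : IsTestFunction 0 1 φ) (f : L2I) :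
    Integrable (fun x => φ x • f x) volI :=
  ((Lp.memLp f).integrable one_le_two).bdd_smul _ hφ.smooth.continuous.aestronglyMeasurable
    (Filter.Eventually.of_forall (hφ.compact.exists_bound_of_continuous
      hφ.smooth.continuous).choose_spec)

theorem IsTestFunction.deriv {a b : ℝ} {φ : ℝ → ℝ} (hφ : IsTestFunction a b φ) :
    IsTestFunction a b (deriv φ) where
  smooth := by
    have h : ContDiff ℝ (∞ + 1) φ := hφ.smooth
    exact (contDiff_succ_iff_deriv.1 h).2.2
  compact := hφ.compact.deriv
  support := (tsupport_deriv_subset (f := φ)).trans hφ.support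

theorem IsWeakDeriv.add {f₁ f₂ g₁ g₂ : L2I} (h₁ : IsWeakDeriv 0 1 f₁ g₁)
    (h₂ : IsWeakDeriv 0 1 f₂ g₂) : IsWeakDeriv 0 1 (f₁ + f₂ : L2I) (g₁ + g₂ : L2I) := by
  intro φ hφ
  have e1 : ∫ x in Ioo 0 1, _root_.deriv φ x • (f₁ + f₂ : L2I) x
      = ∫ x in Ioo 0 1, (_root_.deriv φ x • f₁ x + _root_.deriv φ x • f₂ x) := by
    refine integral_congr_ae ?_
    filter_upwards [Lp.coeFn_add f₁ f₂] with x hx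
    rw [hx, Pi.add_apply, smul_add]
  have e2 : ∫ x in Ioo 0 1, φ x • (g₁ + g₂ : L2I) x
      = ∫ x in Ioo 0 1, (φ x • g₁ x + φ x • g₂ x) := by
    refine integral_congr_ae ?_
    filter_upwards [Lp.coeFn_add g₁ g₂] with x hx
    rw [hx, Pi.add_apply, smul_add]
  rw [e1, e2, integral_add (hφ.deriv.integrable_mul f₁) (hφ.deriv.integrable_mul f₂),
    integral_add (hφ.integrable_mul g₁) (hφ.integrable_mul g₂), h₁ φ hφ, h₂ φ hφ]
  ring

theorem IsWeakDeriv.smul {f g : L2I} (c : ℝ) (h : IsWeakDeriv 0 1 f g) :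
    IsWeakDeriv 0 1 (c • f : L2I) (c • g : L2I) := by
  intro φ hφ
  have e1 : ∫ x in Ioo 0 1, _root_.deriv φ x • (c • f : L2I) x
      = ∫ x in Ioo 0 1, c • (_root_.deriv φ x • f x) := by
    refine integral_congr_ae ?_
    filter_upwards [Lp.coeFn_smul c f] with x hx
    rw [hx, Pi.smul_apply, smul_comm]
  have e2 : ∫ x in Ioo 0 1, φ x • (c • g : L2I) x
      = ∫ x in Ioo 0 1, c • (φ x • g x) := by
    refine integral_congr_ae ?_
    filter_upwards [Lp.coeFn_smul c g] with x hx
    rw [hx, Pi.smul_apply, smul_comm]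
  rw [e1, e2, integral_smul, integral_smul, h φ hφ, smul_neg]

theorem isWeakDeriv_zero : IsWeakDeriv 0 1 (0 : L2I) (0 : L2I) := by
  intro φ hφ
  have h : ∀ ψ : ℝ → ℝ, ∫ x in Ioo 0 1, ψ x • (0 : L2I) x = 0 := by
    intro ψ
    refine integral_eq_zero_of_ae ?_
    filter_upwards [Lp.coeFn_zero ℝ 2 volI] with x hx
    rw [hx]; simp
  rw [h, h, neg_zero]

/-- The pairs `(φ, φ')` in `L²(I) × L²(I)`, where `φ` is a test function on `I`. -/
def testGraph : Submodule ℝ (PiLp 2 fun _ : Fin 2 => L2I) where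
  carrier := {p | ∃ φ : ℝ → ℝ, IsTestFunction 0 1 φ ∧
    p 0 =ᵐ[volI] φ ∧ p 1 =ᵐ[volI] deriv φ}
  zero_mem' := by
    refine ⟨fun _ => 0, ⟨contDiff_const, HasCompactSupport.zero, ?_⟩, ?_, ?_⟩
    · have h0 : tsupport (fun _ : ℝ => (0 : ℝ)) = ∅ := tsupport_eq_empty_iff.2 rfl
      rw [h0]; exact empty_subset _
    · exact Lp.coeFn_zero ℝ 2 volI
    · filter_upwards [Lp.coeFn_zero ℝ 2 volI] with x hx
      simpa using hx
  add_mem' := by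
    rintro p q ⟨φ, hφ, hp0, hp1⟩ ⟨χ, hχ, hq0, hq1⟩
    refine ⟨φ + χ, ⟨hφ.smooth.add hχ.smooth, hφ.compact.add hχ.compact, ?_⟩, ?_, ?_⟩
    · exact (tsupport_add φ χ).trans (union_subset hφ.support hχ.support)
    · filter_upwards [Lp.coeFn_add (p 0) (q 0), hp0, hq0] with x h h1 h2
      rw [PiLp.add_apply, h, Pi.add_apply, Pi.add_apply, h1, h2]
    · filter_upwards [Lp.coeFn_add (p 1) (q 1), hp1, hq1] with x h h1 h2
      rw [PiLp.add_apply, h, Pi.add_apply, h1, h2, deriv_add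
        (hφ.smooth.differentiable (by simp) x) (hχ.smooth.differentiable (by simp) x)]
  smul_mem' := by
    rintro c p ⟨φ, hφ, hp0, hp1⟩
    refine ⟨c • φ, ⟨hφ.smooth.const_smul c, hφ.compact.smul_left (f := fun _ => c), ?_⟩, ?_, ?_⟩
    · exact (tsupport_smul_subset_right (fun _ => c) φ).trans hφ.support
    · filter_upwards [Lp.coeFn_smul c (p 0), hp0] with x h h1
      rw [PiLp.smul_apply, h, Pi.smul_apply, Pi.smul_apply, h1]
    · filter_upwards [Lp.coeFn_smul c (p 1), hp1] with x h h1
      rw [PiLp.smul_apply, h, Pi.smul_apply, h1,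
        deriv_const_smul c (hφ.smooth.differentiable (by simp) x)]

/-- `H¹₀(I)`, the closure of the test functions in the norm of `H¹(I)`. An element `f` is stored
as the pair `(f, f')`, so that the norm is `(‖f‖² + ‖f'‖²)^(1/2)` with `L²(I)` norms. -/
def H10 : Submodule ℝ (PiLp 2 fun _ : Fin 2 => L2I) := testGraph.topologicalClosure

/-- `H(I) = H²(I) ∩ H¹₀(I)`. An element `f` is stored as the triple `(f, f', f'')` of its weak
derivatives, all of them in `L²(I)`, so that the norm is the norm of `H²(I)`. -/
def HI : Submodule ℝ (PiLp 2 fun _ : Fin 3 => L2I) where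
  carrier := {p | IsWeakDeriv 0 1 (p 0) (p 1) ∧ IsWeakDeriv 0 1 (p 1) (p 2) ∧
    !₂[p 0, p 1] ∈ H10}
  zero_mem' := by
    refine ⟨isWeakDeriv_zero, isWeakDeriv_zero, ?_⟩
    convert H10.zero_mem using 1
    ext i : 1
    fin_cases i <;> rfl
  add_mem' := by
    rintro p q ⟨hp1, hp2, hp3⟩ ⟨hq1, hq2, hq3⟩
    refine ⟨hp1.add hq1, hp2.add hq2, ?_⟩
    convert H10.add_mem hp3 hq3 using 1
    ext i : 1
    fin_cases i <;> rfl
  smul_mem' := by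
    rintro c p ⟨hp1, hp2, hp3⟩
    refine ⟨hp1.smul c, hp2.smul c, ?_⟩
    convert H10.smul_mem c hp3 using 1
    ext i : 1
    fin_cases i <;> rfl

/-- The `i`-th weak derivative in `L²(I)` of `f ∈ H(I)`, for `i = 0, 1, 2`. -/
def D (i : Fin 3) (f : HI) : L2I := f.1 i

/-- The convex set `K` of all `f ∈ H(I)` with `f ≥ ψ` in `I`. (For continuous `ψ`, this holds
almost everywhere if and only if the continuous representative of `f` satisfies it
everywhere in `I`.) -/
def K (ψ : ℝ → ℝ) : Set HI := {f | ∀ᵐ x ∂volI, ψ x ≤ D 0 f x}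

/-- `w ∈ L²(0, T; L²(I))` is the weak time derivative of `u`. -/
def IsTimeDeriv (T : ℝ) (u : ℝ → HI) (w : ℝ → L2I) : Prop :=
  MemLp w 2 (volume.restrict (Ioo 0 T)) ∧ IsWeakDeriv 0 T (fun t => D 0 (u t)) w

/-- The set `K_T` of all `u ∈ L^∞(0, T; H(I)) ∩ H¹(0, T; L²(I))` with `u ≥ ψ` in `I × (0, T)`.
Only the values `u t` with `t ∈ (0, T)` matter, up to a null set of times. -/
def KT (ψ : ℝ → ℝ) (T : ℝ) : Set (ℝ → HI) :=
  {u | MemLp u ⊤ (volume.restrict (Ioo 0 T)) ∧ (∃ w, IsTimeDeriv T u w) ∧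
    ∀ᵐ t ∂(volume.restrict (Ioo 0 T)), u t ∈ K ψ}

/-- `|γ_f'| = (1 + (f')²)^(1/2)`, the speed of the graph `γ_f(x) = (x, f(x))`. -/
def speed (f : HI) (x : ℝ) : ℝ := √(1 + D 1 f x ^ 2)

/-- The integrand of the variational inequality at a fixed time, as a function of `x ∈ I`: here
`f` is the value of the solution, `g` that of its time derivative, and `v` that of the test
function. -/
def integrand (lam : ℝ) (f : HI) (g : L2I) (v : HI) (x : ℝ) : ℝ :=
  g x * (D 0 v x - D 0 f x) / speed f x
    + 2 * (D 2 f x * (D 2 v x - D 2 f x) / speed f x ^ 5)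
    - 5 * (|D 2 f x| ^ 2 * D 1 f x * (D 1 v x - D 1 f x) / speed f x ^ 7)
    - lam * (D 2 f x * (D 0 v x - D 0 f x) / speed f x ^ 3)

/-- `u`, with weak time derivative `ut`, is a weak solution on `(0, T)` of the obstacle problem for
the elastic flow with length penalization `lam`, obstacle `ψ` and initial datum `u₀`. -/
structure IsWeakSolution (lam : ℝ) (ψ : ℝ → ℝ) (T : ℝ) (u₀ : HI) (u : ℝ → HI)
    (ut : ℝ → L2I) : Prop where
  mem : u ∈ KT ψ T
  timeDeriv : IsTimeDeriv T u ut
  variational : ∀ v ∈ KT ψ T,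
    0 ≤ ∫ t in Ioo 0 T, ∫ x in Ioo 0 1, integrand lam (u t) (ut t) (v t) x
  initial : ∃ U : ℝ → L2I, ContinuousOn U (Icc 0 T) ∧
    (∀ᵐ t ∂(volume.restrict (Ioo 0 T)), U t = D 0 (u t)) ∧ U 0 = D 0 u₀

end

end ObstacleFlow

namespace ObstacleFlow

/-! Fix `v ∈ K` and a nonnegative test function `η` of time, scaled so that `η ≤ 1`. Since `K` is
convex, `u + η (v - u)` belongs to `K_T` (`add_smul_sub_mem_KT`). Its variation from `u` is `η (v -
u)`, and the integrated expression is linear in the variation (`form_smul`), so the inequality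
becomes `∫ η(t) form(t) dt ≥ 0`. As `η` is arbitrary, `form(t) ≥ 0` for almost every `t`
(`ae_nonneg_of_integral_test`).

The exceptional null set still depends on `v`. Because `H(I)` is separable, countably many `v` dense
in `K` suffice: their null sets have null union, and outside it the inequality passes to all of `K`
by continuity in `v`.

The analytic content is this continuity. The term `|u''|² u' (v-u)'` pairs an `L¹` function with a
derivative, which must be controlled in `L^∞`; the embedding `H¹(I) ⊂ L^∞(I)` provides this
(`exists_ae_abs_le_of_isWeakDeriv`). -/

/-! ### Test functions, mollification and primitives. -/

theorem IsTestFunction.integrable {a b : ℝ} {φ : ℝ → ℝ} (hφ : IsTestFunction a b φ) :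
    Integrable φ :=
  hφ.smooth.continuous.integrable_of_hasCompactSupport hφ.compact

theorem IsTestFunction.integrable_mul_lp {φ : ℝ → ℝ} (hφ : IsTestFunction 0 1 φ) (f : L2I) :
    Integrable (fun x => φ x * f x) volI :=
  hφ.integrable_mul f

theorem IsTestFunction.exists_bound {a b : ℝ} {φ : ℝ → ℝ} (hφ : IsTestFunction a b φ) :
    ∃ M, 0 < M ∧ ∀ x, |φ x| ≤ M := by
  obtain ⟨M, hM⟩ := hφ.compact.exists_bound_of_continuous hφ.smooth.continuous
  exact ⟨max M 1, by positivity, fun x => (hM x).trans (le_max_left _ _)⟩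

theorem IsTestFunction.support_subset {a b : ℝ} {φ : ℝ → ℝ} (hφ : IsTestFunction a b φ) :
    Function.support φ ⊆ Ioo a b :=
  (subset_tsupport φ).trans hφ.support

theorem IsTestFunction.const_mul {a b : ℝ} {φ : ℝ → ℝ} (hφ : IsTestFunction a b φ) (c : ℝ) :
    IsTestFunction a b (fun x => c * φ x) where
  smooth := contDiff_const.mul hφ.smooth
  compact := hφ.compact.mul_left (f := fun _ => c)
  support := (closure_mono (Function.support_const_smul_subset c φ)).trans hφ.support

theorem IsTestFunction.mul_smooth {a b : ℝ} {φ χ : ℝ → ℝ} (hφ : IsTestFunction a b φ)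
    (hχ : ContDiff ℝ ∞ χ) : IsTestFunction a b (fun x => φ x * χ x) where
  smooth := hφ.smooth.mul hχ
  compact := hφ.compact.mul_right
  support := (closure_mono (Function.support_mul_subset_left φ χ)).trans hφ.support

theorem IsTestFunction.sub {a b : ℝ} {φ χ : ℝ → ℝ} (hφ : IsTestFunction a b φ)
    (hχ : IsTestFunction a b χ) : IsTestFunction a b (fun x => φ x - χ x) where
  smooth := hφ.smooth.sub hχ.smooth
  compact := hφ.compact.sub hχ.compact
  support := (tsupport_sub φ χ).trans (union_subset hφ.support hχ.support)

theorem IsTestFunction.integral_deriv_eq_zero {a b : ℝ} {φ : ℝ → ℝ}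
    (hφ : IsTestFunction a b φ) : ∫ x in Ioo a b, _root_.deriv φ x = 0 := by
  rw [setIntegral_eq_integral_of_forall_compl_eq_zero
    (fun x hx => Function.notMem_support.1 fun h => hx (hφ.deriv.support_subset h))]
  exact integral_eq_zero_of_hasDerivAt_of_integrable
    (fun x => (hφ.smooth.differentiable (by simp) x).hasDerivAt) hφ.deriv.integrable hφ.integrable

/-- A normalized bump function, reflected and moved to `c`, is a test function. -/
theorem ContDiffBump.isTestFunction_normed_sub {a b c : ℝ} (φ : ContDiffBump (0 : ℝ))
    (h : Metric.closedBall c φ.rOut ⊆ Ioo a b) :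
    IsTestFunction a b (fun x => φ.normed volume (c - x)) := by
  have hs : tsupport (fun x => φ.normed volume (c - x)) ⊆ Metric.closedBall c φ.rOut := by
    refine closure_minimal (fun x hx => ?_) Metric.isClosed_closedBall
    have : c - x ∈ Function.support (φ.normed volume) := hx
    rw [φ.support_normed_eq, mem_ball_zero_iff] at this
    rw [Metric.mem_closedBall, dist_comm, dist_eq_norm]
    exact this.le
  refine ⟨φ.contDiff_normed.comp (contDiff_const.sub contDiff_id), ?_, hs.trans h⟩
  exact (isCompact_closedBall c _).of_isClosed_subset (isClosed_tsupport _) hs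

/-- A function whose integrals against all nonnegative test functions are nonnegative is
nonnegative almost everywhere. -/
theorem ae_nonneg_of_integral_test {a b : ℝ} {F : ℝ → ℝ} (hF : IntegrableOn F (Ioo a b))
    (h : ∀ η, IsTestFunction a b η → (∀ x, 0 ≤ η x) → 0 ≤ ∫ x in Ioo a b, η x * F x) :
    ∀ᵐ x ∂(volume.restrict (Ioo a b)), 0 ≤ F x := by
  -- The outer radius is twice the inner one: almost everywhere convergence of the mollifications
  -- needs a bounded ratio of radii.
  let φ : ℕ → ContDiffBump (0 : ℝ) := fun n =>
    ⟨1 / ((n : ℝ) + 1), 2 * (1 / ((n : ℝ) + 1)), by positivity, by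
      have : 0 < 1 / ((n : ℝ) + 1) := by positivity
      linarith⟩
  have hlim : Filter.Tendsto (fun n => (φ n).rOut) Filter.atTop (nhds 0) := by
    simpa [φ] using (tendsto_one_div_add_atTop_nhds_zero_nat (𝕜 := ℝ)).const_mul 2
  have hG : Integrable ((Ioo a b).indicator F) := (integrable_indicator_iff measurableSet_Ioo).2 hF
  rw [ae_restrict_iff' measurableSet_Ioo]
  filter_upwards [ContDiffBump.ae_convolution_tendsto_right_of_locallyIntegrable (μ := volume)
    (K := 2) hlim (Filter.Eventually.of_forall fun n => le_rfl) hG.locallyIntegrable] with x hx hxI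
  rw [indicator_of_mem hxI] at hx
  obtain ⟨ε, hε, hball⟩ := Metric.isOpen_iff.1 isOpen_Ioo x hxI
  -- Once the bump around the interior point `x` fits into `(a, b)`, the mollified value at `x` is
  -- an integral of `F` against an admissible test function.
  refine ge_of_tendsto hx ?_
  filter_upwards [(tendsto_order.1 hlim).2 ε hε] with n hn
  have htest := ContDiffBump.isTestFunction_normed_sub (φ n)
    ((Metric.closedBall_subset_ball hn).trans hball)
  refine (h _ htest fun y => (φ n).nonneg_normed _).trans_eq ?_
  rw [convolution_eq_swap, ← integral_indicator measurableSet_Ioo]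
  refine integral_congr_ae (Filter.Eventually.of_forall fun y => ?_)
  by_cases hy : y ∈ Ioo a b <;> simp [hy]

/-- A test function with vanishing integral is the derivative of a test function. -/
theorem IsTestFunction.primitive {θ : ℝ → ℝ} (hθ : IsTestFunction 0 1 θ) (h0 : ∫ x, θ x = 0) :
    IsTestFunction 0 1 (fun x => ∫ t in (0)..x, θ t) ∧
      _root_.deriv (fun x => ∫ t in (0)..x, θ t) = θ := by
  have hd : ∀ x, HasDerivAt (fun x => ∫ t in (0)..x, θ t) (θ x) x := fun x =>
    hθ.smooth.continuous.integral_hasStrictDerivAt 0 x |>.hasDerivAt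
  have hderiv : _root_.deriv (fun x => ∫ t in (0)..x, θ t) = θ := funext fun x => (hd x).deriv
  obtain ⟨c, d, hc, hd1, hcd⟩ : ∃ c d : ℝ, 0 < c ∧ d < 1 ∧ tsupport θ ⊆ Icc c d := by
    -- Adjoining `1 / 2` keeps the set nonempty when `θ = 0`, so that its infimum and supremum lie
    -- in it.
    have hK : IsCompact (tsupport θ ∪ {1 / 2}) := hθ.compact.isCompact.union isCompact_singleton
    have hne : (tsupport θ ∪ {1 / 2}).Nonempty := ⟨1 / 2, by simp⟩
    have hsub : tsupport θ ∪ {1 / 2} ⊆ Ioo 0 1 :=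
      union_subset hθ.support (by rw [singleton_subset_iff]; constructor <;> norm_num)
    exact ⟨_, _, (hsub (hK.sInf_mem hne)).1, (hsub (hK.sSup_mem hne)).2, fun x hx =>
      ⟨csInf_le hK.bddBelow (Or.inl hx), le_csSup hK.bddAbove (Or.inl hx)⟩⟩
  have hs : tsupport (fun x => ∫ t in (0)..x, θ t) ⊆ Icc c d := by
    refine closure_minimal (fun x hx => ?_) isClosed_Icc
    by_contra hxc
    refine hx (?_ : ∫ t in (0)..x, θ t = 0)
    rw [mem_Icc, not_and_or, not_le, not_le] at hxc
    rcases hxc with hxc | hxc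
    -- Left of `c` the integrand vanishes on the interval; right of `d` the interval contains the
    -- whole support and the total integral is zero.
    · refine intervalIntegral.integral_zero_ae (Filter.Eventually.of_forall fun t ht => ?_)
      by_contra hne
      have h1 := (hcd (subset_tsupport θ hne)).1
      have h2 := (uIoc_subset_uIcc ht)
      rw [mem_uIcc] at h2
      rcases h2 with h2 | h2 <;> linarith [h2.1, h2.2]
    · refine (intervalIntegral.integral_eq_integral_of_support_subset fun t ht => ?_).trans h0
      have h1 := hcd (subset_tsupport θ ht)
      exact ⟨hc.trans_le h1.1, h1.2.trans hxc.le⟩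
  refine ⟨⟨contDiff_infty_iff_deriv.2 ⟨fun x => (hd x).differentiableAt, by rw [hderiv]; exact hθ.smooth⟩, ?_, ?_⟩, hderiv⟩
  · exact isCompact_Icc.of_isClosed_subset (isClosed_tsupport _) hs
  · exact hs.trans fun x hx => ⟨hc.trans_le hx.1, hx.2.trans_lt hd1⟩

/-! ### The Sobolev embedding on the unit interval. -/

instance : IsProbabilityMeasure volI := ⟨by simp [volI]⟩

theorem integral_abs_le_norm (f : L2I) : ∫ x, |f x| ∂volI ≤ ‖f‖ := by
  rw [Lp.norm_def]
  have h : ∫ x, |f x| ∂volI = (eLpNorm f 1 volI).toReal := by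
    rw [eLpNorm_one_eq_lintegral_enorm]
    exact integral_norm_eq_lintegral_enorm (Lp.aestronglyMeasurable f)
  rw [h]
  exact ENNReal.toReal_mono (Lp.eLpNorm_ne_top f)
    (eLpNorm_le_eLpNorm_of_exponent_le one_le_two (Lp.aestronglyMeasurable f))

theorem abs_integral_mul_le {φ : ℝ → ℝ} {M : ℝ} (hM : ∀ x, |φ x| ≤ M) (f : L2I) :
    |∫ x, φ x * f x ∂volI| ≤ M * ‖f‖ := by
  have hM0 : 0 ≤ M := (abs_nonneg _).trans (hM 0)
  have hf : Integrable f volI := (Lp.memLp f).integrable one_le_two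
  rw [← Real.norm_eq_abs]
  calc ‖∫ x, φ x * f x ∂volI‖ ≤ ∫ x, M * |f x| ∂volI := by
        refine norm_integral_le_of_norm_le (hf.norm.const_mul M)
          (Filter.Eventually.of_forall fun x => ?_)
        rw [norm_mul, Real.norm_eq_abs]
        exact mul_le_mul_of_nonneg_right (hM x) (norm_nonneg _)
    _ = M * ∫ x, |f x| ∂volI := integral_const_mul _ _
    _ ≤ M * ‖f‖ := mul_le_mul_of_nonneg_left (integral_abs_le_norm f) hM0

/-- The Sobolev embedding `H¹(I) ⊂ L^∞(I)`. -/
theorem exists_ae_abs_le_of_isWeakDeriv : ∃ C : ℝ, 0 ≤ C ∧ ∀ f g : L2I,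
    IsWeakDeriv 0 1 f g → ∀ᵐ x ∂volI, |f x| ≤ C * (‖f‖ + ‖g‖) := by
  let b : ContDiffBump (0 : ℝ) := ⟨1 / 8, 1 / 4, by norm_num, by norm_num⟩
  set χ : ℝ → ℝ := fun x => b.normed volume (1 / 2 - x) with hχdef
  have hχ : IsTestFunction 0 1 χ := by
    refine ContDiffBump.isTestFunction_normed_sub b fun x hx => ?_
    rw [Real.closedBall_eq_Icc, mem_Icc] at hx
    change (1 / 2 - 1 / 4 : ℝ) ≤ x ∧ x ≤ (1 / 2 + 1 / 4 : ℝ) at hx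
    constructor <;> linarith [hx.1, hx.2]
  have hχ0 : ∀ x, 0 ≤ χ x := fun x => b.nonneg_normed _
  have hχ1 : ∫ x, χ x = 1 := by
    rw [hχdef, integral_sub_left_eq_self (fun x => b.normed volume x)]
    exact b.integral_normed
  obtain ⟨M, hM0, hM⟩ := hχ.exists_bound
  refine ⟨M + 2, by positivity, fun f g hfg => ?_⟩
  have hfi : Integrable f volI := (Lp.memLp f).integrable one_le_two
  -- Duality: with `m = ∫ η`, the function `η - m χ` has mean zero, hence is the derivative of a
  -- test function bounded by `2 m`. Moving the derivative onto `f` leaves `g`, and `m ∫ χ f`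
  -- accounts for the remaining `M ‖f‖`.
  have key : ∀ η, IsTestFunction 0 1 η → (∀ x, 0 ≤ η x) →
      |∫ x in Ioo 0 1, η x * f x| ≤ (∫ x in Ioo 0 1, η x) * ((M + 2) * (‖f‖ + ‖g‖)) := by
    intro η hη hη0
    rw [setIntegral_eq_integral_of_forall_compl_eq_zero
      (fun x hx => Function.notMem_support.1 fun h => hx (hη.support_subset h))]
    set m := ∫ x, η x with hm
    have hm0 : 0 ≤ m := integral_nonneg hη0
    have hθ := hη.sub (hχ.const_mul m)
    obtain ⟨hΘ, hΘd⟩ := hθ.primitive (by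
      rw [integral_sub hη.integrable (hχ.const_mul m).integrable, integral_const_mul, hχ1]
      simp [hm])
    have hbd : ∀ x, |∫ t in (0)..x, (η t - m * χ t)| ≤ 2 * m := by
      intro x
      calc |∫ t in (0)..x, (η t - m * χ t)| ≤ ∫ t in uIoc 0 x, ‖η t - m * χ t‖ :=
            intervalIntegral.norm_integral_le_integral_norm_uIoc (f := fun t => η t - m * χ t)
        _ ≤ ∫ t, ‖η t - m * χ t‖ := setIntegral_le_integral hθ.integrable.norm
            (Filter.Eventually.of_forall fun t => norm_nonneg _)
        _ ≤ ∫ t, (η t + m * χ t) := by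
            refine integral_mono hθ.integrable.norm
              (hη.integrable.add (hχ.const_mul m).integrable) fun t => ?_
            have h1 := hη0 t
            have h2 := mul_nonneg hm0 (hχ0 t)
            exact abs_le.2 ⟨by linarith, by linarith⟩
        _ = 2 * m := by
            rw [integral_add hη.integrable (hχ.const_mul m).integrable, integral_const_mul, hχ1]
            ring
    have hw := hfg _ hΘ
    rw [hΘd] at hw
    have e1 : ∫ x in Ioo 0 1, (η x - m * χ x) • f x
        = (∫ x in Ioo 0 1, η x * f x) - m * ∫ x in Ioo 0 1, χ x * f x := by
      rw [← integral_const_mul, ← integral_sub (hη.integrable_mul_lp f)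
        ((hχ.integrable_mul_lp f).const_mul m)]
      refine integral_congr_ae (Filter.Eventually.of_forall fun x => ?_)
      simp only [smul_eq_mul]
      ring
    rw [e1] at hw
    have h1 := abs_integral_mul_le hM f
    have h2 := abs_integral_mul_le hbd g
    simp only [smul_eq_mul] at hw
    rw [sub_eq_iff_eq_add.1 hw]
    calc _ ≤ 2 * m * ‖g‖ + m * (M * ‖f‖) := by
          refine (abs_add_le _ _).trans (add_le_add (by rwa [abs_neg]) ?_)
          rw [abs_mul, abs_of_nonneg hm0]
          exact mul_le_mul_of_nonneg_left h1 hm0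
      _ ≤ _ := by
          have := mul_nonneg hm0 (norm_nonneg f)
          have := mul_nonneg (mul_nonneg hm0 hM0.le) (norm_nonneg g)
          nlinarith
  set B := (M + 2) * (‖f‖ + ‖g‖)
  have e2 : ∀ η, IsTestFunction 0 1 η → ∀ s : ℝ, ∫ x in Ioo 0 1, η x * (B - s * f x)
      = (∫ x in Ioo 0 1, η x) * B - s * ∫ x in Ioo 0 1, η x * f x := by
    intro η hη s
    rw [← integral_const_mul, ← integral_mul_const,
      ← integral_sub (hη.integrable.integrableOn.mul_const B) ((hη.integrable_mul_lp f).const_mul s)]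
    refine integral_congr_ae (Filter.Eventually.of_forall fun x => ?_)
    ring
  have hint : ∀ s : ℝ, IntegrableOn (fun x => B - s * f x) (Ioo 0 1) := fun s =>
    (integrable_const B).sub (hfi.const_mul s)
  have hup := ae_nonneg_of_integral_test (hint 1) fun η hη hη0 => by
    rw [e2 η hη]
    linarith [(abs_le.1 (key η hη hη0)).2]
  have hlow := ae_nonneg_of_integral_test (hint (-1)) fun η hη hη0 => by
    rw [e2 η hη]
    linarith [(abs_le.1 (key η hη hη0)).1]
  filter_upwards [hup, hlow] with x h1 h2
  exact abs_le.2 ⟨by linarith, by linarith⟩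

/-! ### The spatial integral as a continuous functional on `H(I)`. -/

noncomputable section

/-- The weak derivatives as continuous linear maps from `H(I)` to `L²(I)`. -/
def DL (i : Fin 3) : HI →L[ℝ] L2I :=
  (PiLp.proj (𝕜 := ℝ) 2 (fun _ : Fin 3 => L2I) i).comp HI.subtypeL

theorem norm_D_le (i : Fin 3) (f : HI) : ‖D i f‖ ≤ ‖f‖ :=
  PiLp.norm_apply_le f.1 i

theorem norm_Linf_le {f : Lp ℝ ⊤ volI} {c : ℝ} (hc : 0 ≤ c) (h : ∀ᵐ x ∂volI, |f x| ≤ c) :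
    ‖f‖ ≤ c := by
  simpa using Lp.norm_le_of_ae_bound (f := f) hc h

/-- The embedding is applied to the pair `(f', f'')`; both norms are at most `‖f‖`, whence the
factor 2. -/
theorem exists_ae_abs_deriv_le : ∃ C : ℝ, 0 ≤ C ∧ ∀ f : HI, ∀ᵐ x ∂volI, |D 1 f x| ≤ C * ‖f‖ := by
  obtain ⟨C, hC, h⟩ := exists_ae_abs_le_of_isWeakDeriv
  refine ⟨2 * C, by positivity, fun f => ?_⟩
  filter_upwards [h _ _ f.2.2.1] with x hx
  refine hx.trans ?_
  have h1 := mul_le_mul_of_nonneg_left (norm_D_le 1 f) hC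
  have h2 := mul_le_mul_of_nonneg_left (norm_D_le 2 f) hC
  simp only [D] at h1 h2
  linarith

theorem memLp_top_deriv (f : HI) : MemLp (D 1 f) ⊤ volI := by
  obtain ⟨C, -, h⟩ := exists_ae_abs_deriv_le
  exact memLp_top_of_bound (Lp.aestronglyMeasurable _) _ (h f)

/-- The derivative as a continuous linear map from `H(I)` to `L^∞(I)`. -/
def derivTop : HI →L[ℝ] Lp ℝ ⊤ volI :=
  LinearMap.mkContinuousOfExistsBound
    { toFun := fun f => (memLp_top_deriv f).toLp _
      map_add' := fun f g => by
        rw [← MemLp.toLp_add]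
        exact MemLp.toLp_congr _ _ (Lp.coeFn_add (D 1 f) (D 1 g))
      map_smul' := fun c f => by
        rw [RingHom.id_apply, ← MemLp.toLp_const_smul]
        exact MemLp.toLp_congr _ _ (Lp.coeFn_smul c (D 1 f)) }
    (by
      obtain ⟨C, hC, h⟩ := exists_ae_abs_deriv_le
      refine ⟨C, fun f => norm_Linf_le (by positivity) ?_⟩
      filter_upwards [(memLp_top_deriv f).coeFn_toLp, h f] with x h1 h2
      change |(memLp_top_deriv f).toLp _ x| ≤ _
      rwa [h1])

theorem coeFn_derivTop (f : HI) : derivTop f =ᵐ[volI] D 1 f :=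
  (memLp_top_deriv f).coeFn_toLp

/-- The product of a function in `L^∞(I)` and a function in `L²(I)`. -/
def mulL : Lp ℝ ⊤ volI →L[ℝ] L2I →L[ℝ] L2I :=
  (ContinuousLinearMap.mul ℝ ℝ).holderL volI ⊤ 2 2

theorem coeFn_mulL (a : Lp ℝ ⊤ volI) (f : L2I) : mulL a f =ᵐ[volI] fun x => a x * f x :=
  (ContinuousLinearMap.mul ℝ ℝ).coeFn_holder a f

theorem norm_mulL_apply_le (a : Lp ℝ ⊤ volI) (f : L2I) : ‖mulL a f‖ ≤ ‖a‖ * ‖f‖ := by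
  have h := (ContinuousLinearMap.mul ℝ ℝ).norm_holder_apply_apply_le (r := 2) a f
  rwa [ContinuousLinearMap.opNorm_mul, one_mul] at h

/-- Subtracting 1 makes the function vanish at 0, as composition on `Lp` requires; `invSpeed` adds
the constant back. With `A`, `B` the two roots, `B² - A² = b² - a²` and `|a + b| ≤ A + B` give `|B -
A| ≤ |a - b|`, and `A B ≥ 1`. -/
theorem lipschitzWith_inv_sqrt_one_add_sq_sub_one :
    LipschitzWith 1 (fun s : ℝ => (√(1 + s ^ 2))⁻¹ - 1) := by
  refine LipschitzWith.of_dist_le_mul fun a b => ?_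
  simp only [NNReal.coe_one, one_mul, Real.dist_eq, sub_sub_sub_cancel_right]
  have hA : 1 ≤ √(1 + a ^ 2) := Real.one_le_sqrt.2 (by nlinarith)
  have hB : 1 ≤ √(1 + b ^ 2) := Real.one_le_sqrt.2 (by nlinarith)
  have hA' : |a| ≤ √(1 + a ^ 2) := Real.abs_le_sqrt (by linarith)
  have hB' : |b| ≤ √(1 + b ^ 2) := Real.abs_le_sqrt (by linarith)
  have hA2 : √(1 + a ^ 2) ^ 2 = 1 + a ^ 2 := Real.sq_sqrt (by positivity)
  have hB2 : √(1 + b ^ 2) ^ 2 = 1 + b ^ 2 := Real.sq_sqrt (by positivity)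
  set A := √(1 + a ^ 2)
  set B := √(1 + b ^ 2)
  have h1 : |B - A| * (A + B) ≤ |a - b| * (A + B) := by
    have : |B - A| * (A + B) = |a - b| * |a + b| := by
      rw [← abs_of_pos (show 0 < A + B by linarith), ← abs_mul, ← abs_mul, ← abs_neg]
      congr 1
      linarith
    rw [this]
    exact mul_le_mul_of_nonneg_left ((abs_add_le a b).trans (by linarith)) (abs_nonneg _)
  rw [inv_sub_inv (by linarith) (by linarith), abs_div, abs_of_pos (by positivity : 0 < A * B)]
  refine (div_le_self (abs_nonneg _) (by nlinarith)).trans ?_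
  exact le_of_mul_le_mul_right h1 (by linarith)

/-- The function `1 / |γ_f'|` in `L^∞(I)`. -/
def invSpeed (f : HI) : Lp ℝ ⊤ volI :=
  lipschitzWith_inv_sqrt_one_add_sq_sub_one.compLp (by simp) (derivTop f) + Lp.const ⊤ volI 1

theorem coeFn_invSpeed (f : HI) : invSpeed f =ᵐ[volI] fun x => (speed f x)⁻¹ := by
  filter_upwards [Lp.coeFn_add (lipschitzWith_inv_sqrt_one_add_sq_sub_one.compLp (by simp)
    (derivTop f)) (Lp.const ⊤ volI 1), Lp.coeFn_const (p := ⊤) (μ := volI) (1 : ℝ),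
    lipschitzWith_inv_sqrt_one_add_sq_sub_one.coeFn_compLp (by simp) (derivTop f),
    coeFn_derivTop f] with x h1 h2 h3 h4
  rw [invSpeed, h1, Pi.add_apply, h2, h3, Function.comp_apply, h4]
  simp [speed]

theorem continuous_invSpeed : Continuous invSpeed :=
  ((lipschitzWith_inv_sqrt_one_add_sq_sub_one.continuous_compLp (by simp)).comp
    derivTop.continuous).add continuous_const

theorem norm_mulL_invSpeed_le (f : HI) : ‖mulL (invSpeed f)‖ ≤ 1 := by
  refine ContinuousLinearMap.opNorm_le_bound _ zero_le_one fun g => ?_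
  refine (norm_mulL_apply_le _ _).trans (mul_le_mul_of_nonneg_right ?_ (norm_nonneg _))
  refine norm_Linf_le zero_le_one ?_
  filter_upwards [coeFn_invSpeed f] with x hx
  have : 1 ≤ speed f x := Real.one_le_sqrt.2 (by nlinarith)
  rw [hx, abs_of_nonneg (by positivity)]
  exact inv_le_one_of_one_le₀ this

/-- Division by `|γ_f'| ^ k` in `L²(I)`. -/
def divSpeed (k : ℕ) (f : HI) : L2I →L[ℝ] L2I := mulL (invSpeed f) ^ k

/-- Taking powers of the multiplication operator, rather than of the function, reduces this to
continuity of powers in a normed algebra. -/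
theorem continuous_divSpeed (k : ℕ) : Continuous (divSpeed k) :=
  (mulL.continuous.comp continuous_invSpeed).pow k

theorem divSpeed_succ_apply (k : ℕ) (f : HI) (g : L2I) :
    divSpeed (k + 1) f g = mulL (invSpeed f) (divSpeed k f g) := by
  simp only [divSpeed, pow_succ']
  rfl

theorem norm_divSpeed_apply_le (k : ℕ) (f : HI) (g : L2I) : ‖divSpeed k f g‖ ≤ ‖g‖ := by
  induction k with
  | zero => exact le_rfl
  | succ k ih =>
    rw [divSpeed_succ_apply]
    refine ((mulL (invSpeed f)).le_of_opNorm_le (norm_mulL_invSpeed_le f) _).trans ?_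
    rwa [one_mul]

theorem coeFn_divSpeed (k : ℕ) (f : HI) (g : L2I) :
    divSpeed k f g =ᵐ[volI] fun x => g x / speed f x ^ k := by
  induction k with
  | zero => simp [divSpeed]
  | succ k ih =>
    rw [divSpeed_succ_apply]
    filter_upwards [ih, coeFn_mulL (invSpeed f) (divSpeed k f g), coeFn_invSpeed f] with x h1 h2 h3
    rw [h2, h1, h3, pow_succ]
    field_simp

local notation "⟪" x ", " y "⟫" => inner ℝ x y

/-- The left-hand side of the variational inequality at a fixed time, as a functional of the value
`f` of the solution, the value `g` of its time derivative, and the variation `w = v - f`. -/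
def form (lam : ℝ) (f : HI) (g : L2I) (w : HI) : ℝ :=
  ⟪divSpeed 1 f g, D 0 w⟫ + 2 * ⟪divSpeed 5 f (D 2 f), D 2 w⟫
    -- `|f''|²` is split between the two sides so that each factor, `f' f''` and `w' f''`, lies in
    -- `L²`.
    - 5 * ⟪divSpeed 7 f (mulL (derivTop f) (D 2 f)), mulL (derivTop w) (D 2 f)⟫
    - lam * ⟪divSpeed 3 f (D 2 f), D 0 w⟫

theorem continuous_D (i : Fin 3) : Continuous (D i) := (DL i).continuous

theorem _root_.Continuous.divSpeed {X : Type*} [TopologicalSpace X] {a : X → HI} {b : X → L2I}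
    (k : ℕ) (ha : Continuous a) (hb : Continuous b) :
    Continuous fun p => divSpeed k (a p) (b p) :=
  ((continuous_divSpeed k).comp ha).clm_apply hb

theorem _root_.Continuous.mulL_derivTop {X : Type*} [TopologicalSpace X] {a b : X → HI}
    (ha : Continuous a) (hb : Continuous b) :
    Continuous fun p => mulL (derivTop (a p)) (D 2 (b p)) :=
  ((mulL.continuous.comp derivTop.continuous).comp ha).clm_apply ((continuous_D 2).comp hb)

/-- Used twice: continuity in `f`, `g` and `w` jointly gives measurability in time, and continuity
in `w` alone gives the density argument. -/
theorem _root_.Continuous.form {X : Type*} [TopologicalSpace X] {a c : X → HI} {b : X → L2I}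
    (lam : ℝ) (ha : Continuous a) (hb : Continuous b) (hc : Continuous c) :
    Continuous fun p => form lam (a p) (b p) (c p) := by
  have h2 : ∀ i, Continuous fun p => D i (c p) := fun i => (continuous_D i).comp hc
  have h3 : Continuous fun p => D 2 (a p) := (continuous_D 2).comp ha
  have t1 := (ha.divSpeed 1 hb).inner (𝕜 := ℝ) (h2 0)
  have t2 := (ha.divSpeed 5 h3).inner (𝕜 := ℝ) (h2 2)
  have t3 := (ha.divSpeed 7 (ha.mulL_derivTop ha)).inner (𝕜 := ℝ) (hc.mulL_derivTop ha)
  have t4 := (ha.divSpeed 3 h3).inner (𝕜 := ℝ) (h2 0)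
  exact ((t1.add (t2.const_mul 2)).sub (t3.const_mul 5)).sub (t4.const_mul lam)

theorem form_smul (lam : ℝ) (f : HI) (g : L2I) (c : ℝ) (w : HI) :
    form lam f g (c • w) = c * form lam f g w := by
  have hD : ∀ i, D i (c • w) = c • D i w := fun i => (DL i).map_smul c w
  simp only [form, hD, map_smul, inner_smul_right, smul_apply]
  ring

/-- Affine in `‖g‖`, so that `u` bounded in `H(I)` and `∂ₜu` integrable in `L²(I)` yield
integrability in time. Dividing by powers of the speed costs nothing, as it is at least 1. -/
theorem abs_form_le (lam : ℝ) (f : HI) (g : L2I) (w : HI) :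
    |form lam f g w| ≤ (‖g‖ + (2 + 5 * ‖derivTop‖ ^ 2 * ‖f‖ ^ 2 + |lam|) * ‖f‖) * ‖w‖ := by
  have hin : ∀ {x y : L2I} {a b : ℝ}, ‖x‖ ≤ a → ‖y‖ ≤ b → |⟪x, y⟫| ≤ a * b := fun hx hy =>
    (abs_real_inner_le_norm _ _).trans
      (mul_le_mul hx hy (norm_nonneg _) ((norm_nonneg _).trans hx))
  have hdiv : ∀ k, ‖divSpeed k f (D 2 f)‖ ≤ ‖f‖ := fun k =>
    (norm_divSpeed_apply_le k f _).trans (norm_D_le 2 f)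
  have hmul : ∀ h : HI, ‖mulL (derivTop h) (D 2 f)‖ ≤ ‖derivTop‖ * ‖h‖ * ‖f‖ := fun h =>
    (norm_mulL_apply_le _ _).trans (mul_le_mul (derivTop.le_opNorm h) (norm_D_le 2 f)
      (norm_nonneg _) (by positivity))
  have h1 := hin (norm_divSpeed_apply_le 1 f g) (norm_D_le 0 w)
  have h2 := hin (hdiv 5) (norm_D_le 2 w)
  have h3 := hin ((norm_divSpeed_apply_le 7 f _).trans (hmul f)) (hmul w)
  have h4 := mul_le_mul_of_nonneg_left (hin (hdiv 3) (norm_D_le 0 w)) (abs_nonneg lam)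
  rw [← abs_mul] at h4
  rw [form]
  rw [abs_le] at h1 h2 h3 h4 ⊢
  constructor <;> nlinarith [h1.1, h1.2, h2.1, h2.2, h3.1, h3.2, h4.1, h4.2]

theorem integrable_integrand_and_integral_eq (lam : ℝ) (f : HI) (g : L2I) (v : HI) :
    IntegrableOn (integrand lam f g v) (Ioo 0 1) ∧
      ∫ x in Ioo 0 1, integrand lam f g v x = form lam f g (v - f) := by
  set w := v - f
  have hi := fun a b : L2I => L2.integrable_inner (𝕜 := ℝ) a b
  have hform : form lam f g w = ∫ x, (⟪divSpeed 1 f g x, D 0 w x⟫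
      + 2 * ⟪divSpeed 5 f (D 2 f) x, D 2 w x⟫
      - 5 * ⟪divSpeed 7 f (mulL (derivTop f) (D 2 f)) x, mulL (derivTop w) (D 2 f) x⟫
      - lam * ⟪divSpeed 3 f (D 2 f) x, D 0 w x⟫) ∂volI := by
    have e1 := integral_add (hi (divSpeed 1 f g) (D 0 w))
      ((hi (divSpeed 5 f (D 2 f)) (D 2 w)).const_mul 2)
    have e2 := integral_sub ((hi (divSpeed 1 f g) (D 0 w)).add
        ((hi (divSpeed 5 f (D 2 f)) (D 2 w)).const_mul 2))
      ((hi (divSpeed 7 f (mulL (derivTop f) (D 2 f))) (mulL (derivTop w) (D 2 f))).const_mul 5)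
    have e3 := integral_sub (((hi (divSpeed 1 f g) (D 0 w)).add
        ((hi (divSpeed 5 f (D 2 f)) (D 2 w)).const_mul 2)).sub
      ((hi (divSpeed 7 f (mulL (derivTop f) (D 2 f))) (mulL (derivTop w) (D 2 f))).const_mul 5))
      ((hi (divSpeed 3 f (D 2 f)) (D 0 w)).const_mul lam)
    simp only [Pi.add_apply, Pi.sub_apply] at e2 e3
    rw [e3, e2, e1, integral_const_mul, integral_const_mul, integral_const_mul]
    rfl
  have hae : (fun x => ⟪divSpeed 1 f g x, D 0 w x⟫
      + 2 * ⟪divSpeed 5 f (D 2 f) x, D 2 w x⟫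
      - 5 * ⟪divSpeed 7 f (mulL (derivTop f) (D 2 f)) x, mulL (derivTop w) (D 2 f) x⟫
      - lam * ⟪divSpeed 3 f (D 2 f) x, D 0 w x⟫) =ᵐ[volI] integrand lam f g v := by
    filter_upwards [coeFn_divSpeed 1 f g, coeFn_divSpeed 5 f (D 2 f), coeFn_divSpeed 3 f (D 2 f),
      coeFn_divSpeed 7 f (mulL (derivTop f) (D 2 f)), coeFn_mulL (derivTop f) (D 2 f),
      coeFn_mulL (derivTop w) (D 2 f), coeFn_derivTop f, coeFn_derivTop w,
      Lp.coeFn_sub (D 0 v) (D 0 f), Lp.coeFn_sub (D 1 v) (D 1 f), Lp.coeFn_sub (D 2 v) (D 2 f)]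
      with x h1 h2 h3 h4 h5 h6 h7 h8 d0 d1 d2
    have e0 : D 0 w x = D 0 v x - D 0 f x := d0
    have e1 : D 1 w x = D 1 v x - D 1 f x := d1
    have e2 : D 2 w x = D 2 v x - D 2 f x := d2
    rw [h1, h2, h3, h4, h5, h6, h7, h8, e0, e1, e2]
    simp only [integrand, RCLike.inner_apply, conj_trivial, sq_abs, pow_one]
    ring
  refine ⟨?_, ?_⟩
  · exact ((((hi _ _).add ((hi _ _).const_mul 2)).sub ((hi _ _).const_mul 5)).sub
      ((hi _ _).const_mul lam)).congr hae
  · rw [hform]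
    exact (integral_congr_ae hae).symm

end

/-! ### Separability, convexity and test functions depending on time. -/

theorem D_add (i : Fin 3) (f g : HI) : D i (f + g) = D i f + D i g := rfl
theorem D_smul (i : Fin 3) (c : ℝ) (f : HI) : D i (c • f) = c • D i f := rfl

/-- Second countability, unlike separability, passes to arbitrary subspaces, in particular to `K`.
-/
instance : SecondCountableTopology HI := by
  have : Fact ((2 : ENNReal) ≠ ⊤) := ⟨by simp⟩
  have : SecondCountableTopology L2I := inferInstance
  infer_instance

theorem convex_K (ψ : ℝ → ℝ) : Convex ℝ (K ψ) := by
  intro f hf g hg a b ha hb hab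
  filter_upwards [hf, hg, Lp.coeFn_add (a • D 0 f) (b • D 0 g), Lp.coeFn_smul a (D 0 f),
    Lp.coeFn_smul b (D 0 g)] with x h1 h2 h3 h4 h5
  rw [D_add, D_smul, D_smul, h3, Pi.add_apply, h4, h5]
  have e : ψ x = a * ψ x + b * ψ x := by rw [← add_mul, hab, one_mul]
  rw [e]
  exact add_le_add (mul_le_mul_of_nonneg_left h1 ha) (mul_le_mul_of_nonneg_left h2 hb)

theorem IsTestFunction.memLp_top {a b : ℝ} {φ : ℝ → ℝ} (hφ : IsTestFunction a b φ)
    (μ : Measure ℝ) : MemLp φ ⊤ μ := by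
  obtain ⟨M, -, hM⟩ := hφ.exists_bound
  exact memLp_top_of_bound hφ.smooth.continuous.aestronglyMeasurable M
    (Filter.Eventually.of_forall hM)

theorem _root_.MeasureTheory.MemLp.exists_ae_norm_le {E : Type*} [NormedAddCommGroup E] {μ : Measure ℝ} {f : ℝ → E} (hf : MemLp f ⊤ μ) :
    ∃ M, 0 ≤ M ∧ ∀ᵐ t ∂μ, ‖f t‖ ≤ M := by
  have h := hf.eLpNorm_lt_top
  rw [eLpNorm_exponent_top] at h
  refine ⟨(eLpNormEssSup f μ).toReal, ENNReal.toReal_nonneg, ?_⟩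
  filter_upwards [ae_le_eLpNormEssSup (f := f) (μ := μ)] with t ht
  rw [← toReal_enorm]
  exact ENNReal.toReal_mono h.ne ht

variable {E : Type*} [NormedAddCommGroup E] [NormedSpace ℝ E]

theorem IsTestFunction.integrable_smul {a b : ℝ} {φ : ℝ → ℝ} (hφ : IsTestFunction a b φ)
    {μ : Measure ℝ} {f : ℝ → E} (hf : Integrable f μ) : Integrable (fun t => φ t • f t) μ := by
  obtain ⟨M, -, hM⟩ := hφ.exists_bound
  exact hf.bdd_smul _ hφ.smooth.continuous.aestronglyMeasurable (Filter.Eventually.of_forall hM)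

/-- The product rule for the convex combination of a weakly differentiable function and a constant,
with a test function as weight. -/
theorem IsWeakDeriv.add_smul_const_sub [CompleteSpace E] {a b : ℝ} {f g : ℝ → E} {η : ℝ → ℝ}
    (h : IsWeakDeriv a b f g) (hf : IntegrableOn f (Ioo a b)) (hg : IntegrableOn g (Ioo a b))
    (hη : IsTestFunction a b η) (c : E) :
    IsWeakDeriv a b (fun t => f t + η t • (c - f t))
      (fun t => (g t - η t • g t) + deriv η t • (c - f t)) := by
  intro φ hφ
  have hφη : IsTestFunction a b (fun t => φ t * η t) := hφ.mul_smooth hη.smooth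
  have hφη' : IsTestFunction a b (fun t => φ t * deriv η t) := hφ.mul_smooth hη.deriv.smooth
  have hd : ∀ t, deriv (fun t => φ t * η t) t = deriv φ t * η t + φ t * deriv η t := fun t =>
    deriv_fun_mul (hφ.smooth.differentiable (by simp) t) (hη.smooth.differentiable (by simp) t)
  have hc : IntegrableOn (fun _ => c) (Ioo a b) := by
    simp
  -- The weak derivative is tested with `φ` and with `φ η`; the constant `c` contributes nothing
  -- because `(φ η)'` has integral zero.
  have h1 := h φ hφ
  have h2 := h _ hφη
  have h3 : ∫ t in Ioo a b, deriv (fun t => φ t * η t) t • c = 0 := by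
    rw [integral_smul_const, hφη.integral_deriv_eq_zero, zero_smul]
  have i1 := hφ.deriv.integrable_smul hf
  have i2 := hφη.deriv.integrable_smul hf
  have i3 := hφη.deriv.integrable_smul hc
  have i4 : IntegrableOn (fun t => (φ t * deriv η t) • (c - f t)) (Ioo a b) :=
    hφη'.integrable_smul (hc.sub hf)
  have i5 := hφ.integrable_smul hg
  have i6 := hφη.integrable_smul hg
  have i7 : IntegrableOn (fun t => deriv (fun t => φ t * η t) t • c
      - deriv (fun t => φ t * η t) t • f t) (Ioo a b) := i3.sub i2
  have i8 : IntegrableOn (fun t => deriv φ t • f t + (deriv (fun t => φ t * η t) t • c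
      - deriv (fun t => φ t * η t) t • f t)) (Ioo a b) := i1.add i7
  have i9 : IntegrableOn (fun t => φ t • g t - (φ t * η t) • g t) (Ioo a b) := i5.sub i6
  have e1 : ∫ t in Ioo a b, deriv φ t • (f t + η t • (c - f t))
      = (∫ t in Ioo a b, deriv φ t • f t)
        + ((∫ t in Ioo a b, deriv (fun t => φ t * η t) t • c)
          - ∫ t in Ioo a b, deriv (fun t => φ t * η t) t • f t)
        - ∫ t in Ioo a b, (φ t * deriv η t) • (c - f t) := by
    rw [← integral_sub i3 i2, ← integral_add i1 i7, ← integral_sub i8 i4]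
    refine integral_congr_ae (Filter.Eventually.of_forall fun t => ?_)
    simp only [hd]
    module
  have e2 : ∫ t in Ioo a b, φ t • ((g t - η t • g t) + deriv η t • (c - f t))
      = (∫ t in Ioo a b, φ t • g t) - (∫ t in Ioo a b, (φ t * η t) • g t)
        + ∫ t in Ioo a b, (φ t * deriv η t) • (c - f t) := by
    rw [← integral_sub i5 i6, ← integral_add i9 i4]
    refine integral_congr_ae (Filter.Eventually.of_forall fun t => ?_)
    module
  rw [e1, e2, h1, h2, h3]
  abel

/-- The set `K_T` is stable under a smooth convex combination with a time-independent element of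
`K`. -/
theorem add_smul_sub_mem_KT {ψ : ℝ → ℝ} {T : ℝ} {u : ℝ → HI} (hu : u ∈ KT ψ T) {v : HI}
    (hv : v ∈ K ψ) {η : ℝ → ℝ} (hη : IsTestFunction 0 T η) (h0 : ∀ t, 0 ≤ η t)
    (h1 : ∀ t, η t ≤ 1) : (fun t => u t + η t • (v - u t)) ∈ KT ψ T := by
  obtain ⟨hmem, ⟨w, hw, hweak⟩, hK⟩ := hu
  have hc : MemLp (fun _ : ℝ => v) ⊤ (volume.restrict (Ioo 0 T)) := memLp_const v
  have hDu : MemLp (fun t => D 0 (u t)) ⊤ (volume.restrict (Ioo 0 T)) :=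
    (DL 0).comp_memLp' hmem
  have hDc : MemLp (fun _ : ℝ => D 0 v) 2 (volume.restrict (Ioo 0 T)) := memLp_const _
  have hDu2 : MemLp (fun t => D 0 (u t)) 2 (volume.restrict (Ioo 0 T)) := hDu.mono_exponent le_top
  refine ⟨hmem.add ((hc.sub hmem).smul (hη.memLp_top _)),
    ⟨fun t => (w t - η t • w t) + deriv η t • (D 0 v - D 0 (u t)), ?_, ?_⟩, ?_⟩
  · exact (hw.sub (hw.smul (hη.memLp_top _))).add ((hDc.sub hDu2).smul (hη.deriv.memLp_top _))
  · exact hweak.add_smul_const_sub (hDu.integrable le_top) (hw.integrable one_le_two) hη (D 0 v)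
  · filter_upwards [hK] with t ht
    exact (convex_K ψ).add_smul_sub_mem ht hv ⟨h0 t, h1 t⟩

theorem integrable_form {lam T : ℝ} {u : ℝ → HI} {ut : ℝ → L2I}
    (hu : MemLp u ⊤ (volume.restrict (Ioo 0 T))) (hut : MemLp ut 2 (volume.restrict (Ioo 0 T)))
    (v : HI) : IntegrableOn (fun t => form lam (u t) (ut t) (v - u t)) (Ioo 0 T) := by
  obtain ⟨M, hM0, hM⟩ := hu.exists_ae_norm_le
  have hsub : Continuous fun p : HI × L2I => v - p.1 := continuous_const.sub continuous_fst
  have hcont : Continuous fun p : HI × L2I => form lam p.1 p.2 (v - p.1) :=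
    continuous_fst.form lam continuous_snd hsub
  have hmeas : AEStronglyMeasurable (fun t => form lam (u t) (ut t) (v - u t))
      (volume.restrict (Ioo 0 T)) := by
    have h := hcont.comp_aestronglyMeasurable
      (hu.aestronglyMeasurable.prodMk hut.aestronglyMeasurable)
    exact h
  refine Integrable.mono' (((hut.integrable one_le_two).norm.add (integrable_const
    ((2 + 5 * ‖derivTop‖ ^ 2 * M ^ 2 + |lam|) * M))).mul_const (‖v‖ + M)) hmeas ?_
  filter_upwards [hM] with t ht
  refine (abs_form_le lam (u t) (ut t) (v - u t)).trans ?_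
  have hsub : ‖v - u t‖ ≤ ‖v‖ + M := (norm_sub_le _ _).trans (add_le_add le_rfl ht)
  simp only [Pi.add_apply]
  gcongr

/-- For a fixed test function in `K`, the variational inequality holds at almost every time. -/
theorem IsWeakSolution.ae_nonneg_form {lam T : ℝ} {ψ : ℝ → ℝ} {u₀ : HI} {u : ℝ → HI}
    {ut : ℝ → L2I} (hu : IsWeakSolution lam ψ T u₀ u ut) {v : HI} (hv : v ∈ K ψ) :
    ∀ᵐ t ∂(volume.restrict (Ioo 0 T)), 0 ≤ form lam (u t) (ut t) (v - u t) := by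
  refine ae_nonneg_of_integral_test (integrable_form hu.mem.1 hu.timeDeriv.1 v)
    fun η hη hη0 => ?_
  -- Dividing `η` by its bound `M` makes it an admissible convex weight; the positive factor `M⁻¹`
  -- is cancelled at the end.
  obtain ⟨M, hM0, hM⟩ := hη.exists_bound
  have h := hu.variational _ (add_smul_sub_mem_KT hu.mem hv (hη.const_mul M⁻¹)
    (fun t => mul_nonneg (inv_nonneg.2 hM0.le) (hη0 t))
    (fun t => (inv_mul_le_one₀ hM0).2 ((le_abs_self _).trans (hM t))))
  simp only [(integrable_integrand_and_integral_eq _ _ _ _).2, add_sub_cancel_left, form_smul,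
    mul_assoc, integral_const_mul] at h
  exact nonneg_of_mul_nonneg_right h (inv_pos.2 hM0)

end ObstacleFlow

/-! ### A set of times independent of the test function. -/

theorem proposition3p1 (lam : ℝ) (hlam : 0 ≤ lam)
    (ψ : ℝ → ℝ) (hψ : ContinuousOn ψ (Icc 0 1)) (hψ0 : ψ 0 < 0) (hψ1 : ψ 1 < 0)
    (T : ℝ) (hT : 0 < T)
    (u₀ : ObstacleFlow.HI) (hu₀ : u₀ ∈ ObstacleFlow.K ψ)
    (u : ℝ → ObstacleFlow.HI) (ut : ℝ → ObstacleFlow.L2I)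
    (hu : ObstacleFlow.IsWeakSolution lam ψ T u₀ u ut) :
    ∃ S : Set ℝ, S ⊆ Icc 0 T ∧ volume (Icc 0 T \ S) = 0 ∧
      ∀ t ∈ S, ∀ v ∈ ObstacleFlow.K ψ,
        IntegrableOn (ObstacleFlow.integrand lam (u t) (ut t) v) (Ioo 0 1) ∧
        0 ≤ ∫ x in Ioo 0 1, ObstacleFlow.integrand lam (u t) (ut t) v x := by
  -- The dense set is taken in the subtype `K`, not in `H(I)`, so that its members are admissible
  -- test functions.
  obtain ⟨Q, hQ, hQd⟩ := TopologicalSpace.exists_countable_dense (ObstacleFlow.K ψ)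
  refine ⟨{t ∈ Icc 0 T | ∀ v ∈ Q, 0 ≤ ObstacleFlow.form lam (u t) (ut t) (v - u t)},
    fun t ht => ht.1, ?_, ?_⟩
  · have h : ∀ᵐ t ∂(volume.restrict (Icc 0 T)),
        ∀ v ∈ Q, 0 ≤ ObstacleFlow.form lam (u t) (ut t) (v - u t) := by
      rw [← restrict_Ioo_eq_restrict_Icc, ae_ball_iff hQ]
      exact fun v _ => hu.ae_nonneg_form v.2
    rw [ae_restrict_iff' measurableSet_Icc] at h
    refine measure_mono_null (fun t ht => ?_) (ae_iff.1 h)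
    exact fun h' => ht.2 ⟨ht.1, h' ht.1⟩
  · rintro t ⟨-, ht⟩ v hv
    obtain ⟨hint, heq⟩ := ObstacleFlow.integrable_integrand_and_integral_eq lam (u t) (ut t) v
    refine ⟨hint, heq ▸ ?_⟩
    have hsub : Continuous fun v : ObstacleFlow.K ψ => (v : ObstacleFlow.HI) - u t :=
      continuous_subtype_val.sub continuous_const
    have hcont : Continuous fun v : ObstacleFlow.K ψ =>
        ObstacleFlow.form lam (u t) (ut t) (v - u t) :=
      continuous_const.form lam continuous_const hsub
    -- At a fixed good time the admissible `v` satisfying the inequality form a closed subset of `K`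
    -- containing the dense set `Q`, hence all of `K`.
    have hclosed : IsClosed {v : ObstacleFlow.K ψ |
        0 ≤ ObstacleFlow.form lam (u t) (ut t) (v - u t)} := isClosed_le continuous_const hcont
    have hsubset : Q ⊆ {v : ObstacleFlow.K ψ |
        0 ≤ ObstacleFlow.form lam (u t) (ut t) (v - u t)} := fun v hv => ht v hv
    have hmem := hclosed.closure_subset_iff.2 hsubset (hQd ⟨v, hv⟩)
    exact hmem
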